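/- Let $d\ge 1$, $\alpha>0$ and $\sigma>0$, let $\Omega=\{x\in\mathbb R^d:\|x\|_2\le 1\}$ and let $\mu$ be the uniform distribution on $\Omega$. For $\alpha=k+\theta$ with $k\in\mathbb N_0$ and $\theta\in[0,1)$, let $W^{\alpha,\infty}(\mathbb R^d)$ be the space of $f\in L^\infty(\mathbb R^d)$ whose weak derivatives of order at most $k$ exist and for which $$\|f\|_{W^{\alpha,\infty}(\mathbb R^d)}=\sum_{|\beta|\le k}\|\partial^\beta f\|_{L^\infty(\mathbb R^d)}+\mathbf 1_{\{\theta>0\}}\sum_{|\beta|=k}\Big\|\frac{\partial^\beta f(x)-\partial^\beta f(y)}{\|x-y\|_2^{\theta}}\Big\|_{L^\infty(\mathbb R^d\times\mathbb R^d)}<\infty ,$$ and let $W^{\alpha,\infty}(\Omega)$ be the space of restrictions to $\Omega$, with $\|f\|_{W^{\alpha,\infty}(\Omega)}=\inf\{\|g\|_{W^{\alpha,\infty}(\mathbb R^d)}: g|_\Omega=f\text{ a.e.}\}$. For a function $f$ on $\Omega$, let $(x_1,y_1),\dots,(x_n,y_n)$ be i.i.d. with $x_i\sim\mu$ and $y_i=f(x_i)+\eta_i$,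 where $\eta_i\sim\mathcal N(0,\sigma^2)$ is independent of $x_i$, and let $\mathbb E_f$ be the expectation over this sample. Then there is a constant $c>0$, depending only on $d$, $\alpha$ and $\sigma$, such that for every $n\ge 1$ $$\inf_{\hat f}\ \sup_{\|f\|_{W^{\alpha,\infty}(\Omega)}\le 1}\ \mathbb E_f\Big[\|\hat f-f\|_{L^2(\mu)}^2\Big]\ \ge\ c\,n^{-\frac{2\alpha}{2\alpha+d}},$$ where the infimum is over all estimators, that is, all measurable functions $\hat f$ of the sample $\{(x_i,y_i)\}_{i=1}^n$. -/

import Mathlib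

open MeasureTheory ProbabilityTheory
open scoped ENNReal NNReal ContDiff

noncomputable section

namespace SobolevMinimax

/-- `d`-dimensional Euclidean space. -/
abbrev E (d : ℕ) : Type := EuclideanSpace ℝ (Fin d)

/-- The classical partial derivative in the `i`-th coordinate direction. -/
def pderiv {d : ℕ} (i : Fin d) (φ : E d → ℝ) : E d → ℝ :=
  fun x => fderiv ℝ φ x (EuclideanSpace.single i 1)

/-- The classical mixed derivative of multi-index `β`, differentiating `β i` times in direction `i`
(used for smooth functions only, so the order of the directions is immaterial). -/
def multiDeriv {d : ℕ} (β : Fin d → ℕ) (φ : E d → ℝ) : E d → ℝ :=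
  (List.finRange d).foldr (fun i ψ => (pderiv i)^[β i] ψ) φ

/-- `g` is a weak derivative of `f` on the whole space, of multi-index `β`. -/
def IsWeakDeriv {d : ℕ} (β : Fin d → ℕ) (f g : E d → ℝ) : Prop :=
  LocallyIntegrable f volume ∧ LocallyIntegrable g volume ∧
    ∀ φ : E d → ℝ, ContDiff ℝ ∞ φ → HasCompactSupport φ →
      ∫ x, f x * multiDeriv β φ x = (-1) ^ (∑ i, β i) * ∫ x, g x * φ x

/-- The `L^p`-norm, on the product space, of the difference quotient
`(g x - g y) / ‖x - y‖ ^ (d / p + θ)`. For `p = ∞` the exponent is `θ`. -/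
def slobodeckijSeminorm {d : ℕ} (θ : ℝ) (p : ℝ≥0∞) (g : E d → ℝ) : ℝ≥0∞ :=
  eLpNorm (fun z : E d × E d => (g z.1 - g z.2) / ‖z.1 - z.2‖ ^ ((d : ℝ) * (p⁻¹).toReal + θ)) p
    ((volume : Measure (E d)).prod volume)

/-- The Sobolev norm expression of order `α`, formed with `D β` in the place of `∂^β f`:
the sum of the `L^p`-norms of order at most `⌊α⌋` and, if `α` is not an integer, of the
fractional seminorms in the top order `⌊α⌋`. -/
def sobolevSum {d : ℕ} (α : ℝ) (p : ℝ≥0∞) (D : (Fin d → ℕ) → E d → ℝ) : ℝ≥0∞ :=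
  (∑ j ∈ Finset.range (⌊α⌋₊ + 1), ∑ β ∈ Finset.piAntidiag (Finset.univ : Finset (Fin d)) j,
      eLpNorm (D β) p volume) +
    if (⌊α⌋₊ : ℝ) = α then 0
    else ∑ β ∈ Finset.piAntidiag (Finset.univ : Finset (Fin d)) ⌊α⌋₊,
      slobodeckijSeminorm (α - ⌊α⌋₊) p (D β)

/-- The norm of `W^{α,p}(ℝ^d)`. Weak derivatives are unique almost everywhere, so that the infimum
is over equal values; it is `∞` if some weak derivative of order at most `⌊α⌋` does not exist. -/
def sobolevNorm {d : ℕ} (α : ℝ) (p : ℝ≥0∞) (f : E d → ℝ) : ℝ≥0∞ :=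
  ⨅ (D : (Fin d → ℕ) → E d → ℝ) (_ : ∀ β, ∑ i, β i ≤ ⌊α⌋₊ → IsWeakDeriv β f (D β)),
    sobolevSum α p D

/-- The norm of the restricted space `W^{α,p}(Ω)`: the infimum of the norms of the extensions to
`ℝ^d`. It depends only on the restriction of `f` to `Ω`, up to null sets, and is `∞` if `f` has
no extension in `W^{α,p}(ℝ^d)`. -/
def sobolevNormOn {d : ℕ} (Ω : Set (E d)) (α : ℝ) (p : ℝ≥0∞) (f : E d → ℝ) : ℝ≥0∞ :=
  ⨅ (g : E d → ℝ) (_ : g =ᵐ[volume.restrict Ω] f), sobolevNorm α p g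

/-- The closed unit ball of `W^{α,p}(Ω)`. -/
def sobolevUnitBall {d : ℕ} (Ω : Set (E d)) (α : ℝ) (p : ℝ≥0∞) : Set (E d → ℝ) :=
  {f | sobolevNormOn Ω α p f ≤ 1}

/-- The law of `(X, f X + η)` with `X ∼ μ` and independent noise `η ∼ N(0, σ²)`. -/
def sampleLaw {d : ℕ} (μ : Measure (E d)) (σ : ℝ≥0) (f : E d → ℝ) : Measure (E d × ℝ) :=
  (μ.prod (gaussianReal 0 (σ ^ 2))).map (fun z => (z.1, f z.1 + z.2))

/-- An estimator from `n` observations, as a measurable function of the sample and the point. -/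
def IsEstimator {d n : ℕ} (fhat : (Fin n → E d × ℝ) → E d → ℝ) : Prop :=
  Measurable (Function.uncurry fhat)

/-- The expected squared `L²(μ)`-error of `fhat` on `n` i.i.d. observations, when the regression
function is `f`. -/
def risk {d n : ℕ} (μ : Measure (E d)) (σ : ℝ≥0) (fhat : (Fin n → E d × ℝ) → E d → ℝ)
    (f : E d → ℝ) : ℝ≥0∞ :=
  ∫⁻ z, eLpNorm (fun x => fhat z x - f x) 2 μ ^ 2 ∂(Measure.pi fun _ : Fin n => sampleLaw μ σ f)

/-- The minimax risk over the function class `F`, for `n` observations. -/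
def minimaxRisk {d : ℕ} (μ : Measure (E d)) (σ : ℝ≥0) (F : Set (E d → ℝ)) (n : ℕ) : ℝ≥0∞ :=
  ⨅ (fhat : (Fin n → E d × ℝ) → E d → ℝ) (_ : IsEstimator fhat), ⨆ f ∈ F, risk μ σ fhat f

end SobolevMinimax

end

/-! This is Assouad's method with Hellinger affinity. Place `m ^ d` disjoint copies of one smooth
bump in the ball, dilated by `r = 3md` and of height `a * r ^ (-α)`, and let every subset of them be
switched on. Derivatives of order `j` cost `r ^ j` and the Hölder seminorm brings the total to `r ^
α`; since the supports are separated, the number of bumps does not enter. A small `a` thus puts the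
whole hypercube in the unit ball (`exists_sobolevNorm_bumpSum_le`, `exists_profile`).

Switching one bump moves the function by a squared `L²(μ)`-distance `S` of order `r ^ (-(2α + d))`.
If `n ≤ m ^ (2α + d)`, then `S ≤ 4σ² / n`, and the two laws of the `n` observations have affinity at
least `1/2` (`half_le_affinity_pow`). No estimator is then accurate for both on the support of that
bump (`sq_mul_affinity_le`, `le_localRisk_add`). Averaging over the hypercube adds these local
losses to `m ^ d * S / 16`, of order `m ^ (-2α)` (`card_mul_le_minimaxRisk`, `grid_le_minimaxRisk`).
Taking `m` of order `n ^ (1 / (2α + d))` gives the rate. -/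

namespace SobolevMinimax

/-! ### Product densities and the two-point bound -/

section Products

variable {Z : Type*} [MeasurableSpace Z]

/-- Fubini for a product of functions of the separate coordinates. -/
lemma lintegral_pi_prod_eq_prod {n : ℕ} (ν : Measure Z) [SigmaFinite ν]
    (f : Fin n → Z → ℝ≥0∞) (hf : ∀ i, Measurable (f i)) :
    ∫⁻ z, ∏ i, f i (z i) ∂(Measure.pi fun _ : Fin n => ν) = ∏ i, ∫⁻ x, f i x ∂ν := by
  induction n with
  | zero => simp
  | succ n ih =>
    have hmp := (measurePreserving_piFinSuccAbove (fun _ : Fin (n + 1) => ν) 0).symm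
    rw [← hmp.lintegral_comp_emb (MeasurableEquiv.measurableEmbedding _)]
    simp only [Fin.prod_univ_succ, MeasurableEquiv.piFinSuccAbove_symm_apply,
      Fin.insertNthEquiv, Equiv.coe_fn_mk, Fin.insertNth_zero', Fin.cons_zero, Fin.cons_succ]
    rw [lintegral_prod_mul (f := f 0)
      (g := fun y : Fin n → Z => ∏ i : Fin n, f i.succ (y i)) (hf 0).aemeasurable
      (Finset.measurable_prod _ fun i _ =>
        (hf i.succ).comp (measurable_pi_apply i)).aemeasurable, ih _ fun i => hf i.succ]

/-- A product of measures with densities has the product density. -/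
lemma pi_withDensity {n : ℕ} (ν : Measure Z) [SigmaFinite ν] (p : Z → ℝ≥0∞) (hp : Measurable p)
    [SigmaFinite (ν.withDensity p)] :
    Measure.pi (fun _ : Fin n => ν.withDensity p) =
      (Measure.pi fun _ : Fin n => ν).withDensity (fun z => ∏ i, p (z i)) := by
  refine Measure.pi_eq fun s hs => ?_
  rw [withDensity_apply _ (MeasurableSet.univ_pi hs), ← lintegral_indicator
    (MeasurableSet.univ_pi hs)]
  have : ∀ z : Fin n → Z, (Set.univ.pi s).indicator (fun z => ∏ i, p (z i)) z =
      ∏ i, (s i).indicator p (z i) := by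
    intro z
    by_cases hz : z ∈ Set.univ.pi s
    · rw [Set.indicator_of_mem hz]
      exact Finset.prod_congr rfl fun i _ => (Set.indicator_of_mem (hz i (Set.mem_univ i)) p).symm
    · rw [Set.indicator_of_notMem hz]
      simp only [Set.mem_pi, Set.mem_univ, true_implies, not_forall] at hz
      obtain ⟨i, hi⟩ := hz
      exact (Finset.prod_eq_zero (Finset.mem_univ i) (Set.indicator_of_notMem hi p)).symm
  simp_rw [this]
  rw [lintegral_pi_prod_eq_prod ν _ fun i => hp.indicator (hs i)]
  exact Finset.prod_congr rfl fun i _ => by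
    rw [withDensity_apply _ (hs i), lintegral_indicator (hs i)]

/-- The two-point bound: if no point is close to both hypotheses, the sum of the two risks is
bounded below through the Hellinger affinity of the two laws. -/
lemma sq_mul_affinity_le (ν : Measure Z) {p q A B : Z → ℝ≥0∞} (hp : Measurable p)
    (hq : Measurable q) (hA : Measurable A) (hB : Measurable B) (hp1 : ∫⁻ z, p z ∂ν ≤ 1)
    (hq1 : ∫⁻ z, q z ∂ν ≤ 1) (D : ℝ≥0∞)
    (hD : ∀ z, D ≤ A z ^ (1 / 2 : ℝ) + B z ^ (1 / 2 : ℝ)) :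
    (D * ∫⁻ z, (p z * q z) ^ (1 / 2 : ℝ) ∂ν) ^ 2 ≤
      2 * (∫⁻ z, p z * A z ∂ν + ∫⁻ z, q z * B z ∂ν) := by
  -- Cauchy–Schwarz for `√(pA)` and `√q`, where `q` has mass at most one. It is used a second time
  -- with the hypotheses exchanged.
  have key : ∀ {p q A : Z → ℝ≥0∞}, Measurable p → Measurable q → Measurable A →
      ∫⁻ z, q z ∂ν ≤ 1 → ∫⁻ z, A z ^ (1 / 2 : ℝ) * (p z * q z) ^ (1 / 2 : ℝ) ∂ν ≤
        (∫⁻ z, p z * A z ∂ν) ^ (1 / 2 : ℝ) := by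
    intro p q A hp hq hA hq1
    have h := ENNReal.lintegral_mul_le_Lp_mul_Lq ν Real.HolderConjugate.two_two
      (f := fun z => (p z * A z) ^ (1 / 2 : ℝ)) (g := fun z => q z ^ (1 / 2 : ℝ))
      ((hp.mul hA).pow_const _).aemeasurable (hq.pow_const _).aemeasurable
    simp only [Pi.mul_apply, ← ENNReal.rpow_mul] at h
    norm_num only [ENNReal.rpow_one] at h
    calc ∫⁻ z, A z ^ (1 / 2 : ℝ) * (p z * q z) ^ (1 / 2 : ℝ) ∂ν
        = ∫⁻ z, (p z * A z) ^ (1 / 2 : ℝ) * q z ^ (1 / 2 : ℝ) ∂ν := by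
          refine lintegral_congr fun z => ?_
          rw [← ENNReal.mul_rpow_of_nonneg _ _ (by norm_num),
            ← ENNReal.mul_rpow_of_nonneg _ _ (by norm_num)]
          congr 1
          ring
      _ ≤ (∫⁻ z, p z * A z ∂ν) ^ (1 / 2 : ℝ) * (∫⁻ z, q z ∂ν) ^ (1 / 2 : ℝ) := h
      _ ≤ (∫⁻ z, p z * A z ∂ν) ^ (1 / 2 : ℝ) * 1 := by
          gcongr
          exact ENNReal.rpow_le_one hq1 (by norm_num)
      _ = _ := mul_one _
  have h1 : D * ∫⁻ z, (p z * q z) ^ (1 / 2 : ℝ) ∂ν ≤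
      (∫⁻ z, p z * A z ∂ν) ^ (1 / 2 : ℝ) + (∫⁻ z, q z * B z ∂ν) ^ (1 / 2 : ℝ) := by
    have hpq : Measurable fun z => (p z * q z) ^ (1 / 2 : ℝ) := (hp.mul hq).pow_const _
    rw [← lintegral_const_mul _ hpq]
    calc ∫⁻ z, D * (p z * q z) ^ (1 / 2 : ℝ) ∂ν
        ≤ ∫⁻ z, A z ^ (1 / 2 : ℝ) * (p z * q z) ^ (1 / 2 : ℝ) +
            B z ^ (1 / 2 : ℝ) * (q z * p z) ^ (1 / 2 : ℝ) ∂ν := by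
          refine lintegral_mono fun z => ?_
          rw [mul_comm (q z), ← add_mul]
          exact mul_le_mul_left (hD z) _
      _ = _ := lintegral_add_left ((hA.pow_const _).mul ((hp.mul hq).pow_const _)) _
      _ ≤ _ := add_le_add (key hp hq hA hq1) (key hq hp hB hp1)
  have hsq : ∀ a : ℝ≥0∞, (a ^ (1 / 2 : ℝ)) ^ (2 : ℝ) = a := fun a => by
    rw [← ENNReal.rpow_mul]; norm_num
  have h2 := ENNReal.rpow_add_le_mul_rpow_add_rpow ((∫⁻ z, p z * A z ∂ν) ^ (1 / 2 : ℝ))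
    ((∫⁻ z, q z * B z ∂ν) ^ (1 / 2 : ℝ)) (p := 2) (by norm_num)
  rw [hsq, hsq] at h2
  norm_num only [ENNReal.rpow_one, ENNReal.rpow_two] at h2
  exact (pow_le_pow_left₀ zero_le h1 2).trans h2

end Products

/-! ### Affinity of Gaussian densities -/

section Gaussian

/-- Completing the square: `(y - a)² + (y - b)² = 2 (y - (a + b) / 2)² + (a - b)² / 2`. -/
lemma sqrt_gaussianPDF_mul (a b : ℝ) {v : ℝ≥0} (hv : v ≠ 0) (y : ℝ) :
    (gaussianPDF a v y * gaussianPDF b v y) ^ (1 / 2 : ℝ) =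
      ENNReal.ofReal (Real.exp (-((a - b) ^ 2 / (8 * v)))) * gaussianPDF ((a + b) / 2) v y := by
  have hv' : (0 : ℝ) < v := by positivity
  simp only [gaussianPDF]
  have h : gaussianPDFReal a v y * gaussianPDFReal b v y =
      (Real.exp (-((a - b) ^ 2 / (8 * v))) * gaussianPDFReal ((a + b) / 2) v y) ^ 2 := by
    simp only [gaussianPDFReal, mul_pow, ← Real.exp_nat_mul]
    rw [mul_mul_mul_comm, ← Real.exp_add, mul_left_comm, ← Real.exp_add, ← sq]
    congr 2
    push_cast
    field_simp
    ring
  have h0 : 0 ≤ Real.exp (-((a - b) ^ 2 / (8 * v))) * gaussianPDFReal ((a + b) / 2) v y :=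
    mul_nonneg (Real.exp_pos _).le (gaussianPDFReal_nonneg _ _ _)
  rw [← ENNReal.ofReal_mul (gaussianPDFReal_nonneg _ _ _), h,
    ENNReal.ofReal_rpow_of_nonneg (sq_nonneg _) (by norm_num), ← Real.sqrt_eq_rpow,
    Real.sqrt_sq h0, ENNReal.ofReal_mul (Real.exp_pos _).le]

/-- The Hellinger affinity of two Gaussians of equal variance. -/
lemma lintegral_sqrt_gaussianPDF_mul (a b : ℝ) {v : ℝ≥0} (hv : v ≠ 0) :
    ∫⁻ y, (gaussianPDF a v y * gaussianPDF b v y) ^ (1 / 2 : ℝ) =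
      ENNReal.ofReal (Real.exp (-((a - b) ^ 2 / (8 * v)))) := by
  simp_rw [sqrt_gaussianPDF_mul a b hv]
  rw [lintegral_const_mul _ (measurable_gaussianPDF _ _), lintegral_gaussianPDF_eq_one _ hv,
    mul_one]

end Gaussian

/-! ### Affinity of the sample laws -/

section SampleLaw

variable {d : ℕ}

/-- The density of `sampleLaw μ σ f` with respect to `μ ⊗ volume`. -/
noncomputable def sampleDensity (σ : ℝ≥0) (f : E d → ℝ) (z : E d × ℝ) : ℝ≥0∞ :=
  gaussianPDF (f z.1) (σ ^ 2) z.2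

lemma measurable_sampleDensity (σ : ℝ≥0) {f : E d → ℝ} (hf : Measurable f) :
    Measurable (sampleDensity σ f) :=
  measurable_uncurry_gaussianPDF.comp
    ((hf.comp measurable_fst).prodMk (measurable_const.prodMk measurable_snd))

/-- Given the design point, the response is a translate of the noise. The dominating measure does
not depend on `f`, so the two-point bound can compare all hypotheses. -/
lemma sampleLaw_eq_withDensity (μ : Measure (E d)) [SFinite μ] {σ : ℝ≥0} (hσ : σ ≠ 0)
    {f : E d → ℝ} (hf : Measurable f) :
    sampleLaw μ σ f = (μ.prod volume).withDensity (sampleDensity σ f) := by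
  have hv : σ ^ 2 ≠ 0 := pow_ne_zero 2 hσ
  have hT : Measurable fun z : E d × ℝ => (z.1, f z.1 + z.2) :=
    measurable_fst.prodMk ((hf.comp measurable_fst).add measurable_snd)
  ext s hs
  rw [sampleLaw, Measure.map_apply hT hs, Measure.prod_apply (hT hs), withDensity_apply _ hs,
    ← lintegral_indicator hs, lintegral_prod _
      ((measurable_sampleDensity σ hf).indicator hs).aemeasurable]
  refine lintegral_congr fun x => ?_
  have hsx : MeasurableSet (Prod.mk x ⁻¹' s) := measurable_prodMk_left hs
  have h1 : Prod.mk x ⁻¹' ((fun z : E d × ℝ => (z.1, f z.1 + z.2)) ⁻¹' s) =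
      (fun y => f x + y) ⁻¹' (Prod.mk x ⁻¹' s) := rfl
  rw [h1, ← Measure.map_apply (measurable_const_add _) hsx, gaussianReal_map_const_add, zero_add,
    gaussianReal_apply _ hv, ← lintegral_indicator hsx]
  rfl

lemma isProbabilityMeasure_sampleLaw (μ : Measure (E d)) [IsProbabilityMeasure μ] (σ : ℝ≥0)
    {f : E d → ℝ} (hf : Measurable f) : IsProbabilityMeasure (sampleLaw μ σ f) :=
  Measure.isProbabilityMeasure_map
    (measurable_fst.prodMk ((hf.comp measurable_fst).add measurable_snd)).aemeasurable

/-- Close regression functions have sample laws of large Hellinger affinity. -/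
lemma one_le_affinity_add (μ : Measure (E d)) [IsProbabilityMeasure μ] {σ : ℝ≥0} (hσ : σ ≠ 0)
    {f g : E d → ℝ} (hf : Measurable f) (hg : Measurable g) :
    1 ≤ ∫⁻ z, (sampleDensity σ f z * sampleDensity σ g z) ^ (1 / 2 : ℝ) ∂(μ.prod volume) +
      (∫⁻ x, ‖f x - g x‖ₑ ^ 2 ∂μ) * ENNReal.ofReal (1 / (8 * (σ : ℝ) ^ 2)) := by
  have hv : σ ^ 2 ≠ 0 := pow_ne_zero 2 hσ
  have hm : Measurable fun z => (sampleDensity σ f z * sampleDensity σ g z) ^ (1 / 2 : ℝ) :=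
    ((measurable_sampleDensity σ hf).mul (measurable_sampleDensity σ hg)).pow_const _
  rw [lintegral_prod _ hm.aemeasurable]
  simp only [sampleDensity, lintegral_sqrt_gaussianPDF_mul _ _ hv]
  rw [← lintegral_mul_const _ (by fun_prop), ← lintegral_add_left (by fun_prop)]
  calc (1 : ℝ≥0∞) = ∫⁻ _, 1 ∂μ := by simp
    _ ≤ _ := by
      refine lintegral_mono fun x => ?_
      rw [Real.enorm_eq_ofReal_abs, ← ENNReal.ofReal_pow (abs_nonneg _),
        ← ENNReal.ofReal_mul (by positivity), ← ENNReal.ofReal_add (Real.exp_pos _).le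
        (by positivity), ENNReal.one_le_ofReal, sq_abs, mul_one_div]
      -- Pointwise in the design point, `1 - t ≤ exp (-t)` with `t = (f x - g x)² / (8σ²)`.
      have := Real.add_one_le_exp (-((f x - g x) ^ 2 / (8 * ((σ ^ 2 : ℝ≥0) : ℝ))))
      push_cast at this ⊢
      linarith

/-- The affinity of the laws of `n` observations stays bounded below at squared distance of
order `σ² / n`. -/
lemma half_le_affinity_pow (μ : Measure (E d)) [IsProbabilityMeasure μ] {σ : ℝ≥0} (hσ : σ ≠ 0)
    {f g : E d → ℝ} (hf : Measurable f) (hg : Measurable g) {n : ℕ} (hn : 1 ≤ n)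
    (hfg : ∫⁻ x, ‖f x - g x‖ₑ ^ 2 ∂μ ≤ ENNReal.ofReal (4 * (σ : ℝ) ^ 2 / n)) :
    1 / 2 ≤ ∫⁻ z, ((∏ i, sampleDensity σ f (z i)) * ∏ i, sampleDensity σ g (z i)) ^ (1 / 2 : ℝ)
      ∂(Measure.pi fun _ : Fin n => μ.prod volume) := by
  have hm : Measurable fun z => (sampleDensity σ f z * sampleDensity σ g z) ^ (1 / 2 : ℝ) :=
    ((measurable_sampleDensity σ hf).mul (measurable_sampleDensity σ hg)).pow_const _
  have h1 := one_le_affinity_add μ hσ hf hg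
  set ρ := ∫⁻ z, (sampleDensity σ f z * sampleDensity σ g z) ^ (1 / 2 : ℝ) ∂(μ.prod volume)
  -- Affinity is multiplicative over independent observations, which is the reason for using it.
  have h2 : ∫⁻ z, ((∏ i, sampleDensity σ f (z i)) * ∏ i, sampleDensity σ g (z i)) ^ (1 / 2 : ℝ)
      ∂(Measure.pi fun _ : Fin n => μ.prod volume) = ρ ^ n := by
    simp_rw [← Finset.prod_mul_distrib, ← ENNReal.prod_rpow_of_nonneg (show (0 : ℝ) ≤ 1 / 2 by
      norm_num)]
    rw [lintegral_pi_prod_eq_prod _ (fun _ z =>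
      (sampleDensity σ f z * sampleDensity σ g z) ^ (1 / 2 : ℝ)) fun _ => hm]
    simp [ρ]
  rw [h2]
  have hn' : (0 : ℝ) < n := by exact_mod_cast hn
  have hσ' : (0 : ℝ) < σ := by positivity
  have h3 : 1 ≤ ρ + ENNReal.ofReal (1 / (2 * n)) := by
    refine h1.trans (add_le_add_right ((mul_le_mul_left hfg _).trans_eq ?_) _)
    rw [← ENNReal.ofReal_mul (by positivity)]
    congr 1
    field_simp
    norm_num
  have h4 : ENNReal.ofReal (1 + -(1 / (2 * n))) ≤ ρ := by
    rw [← sub_eq_add_neg, ENNReal.ofReal_sub _ (by positivity), ENNReal.ofReal_one]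
    exact tsub_le_iff_right.2 h3
  have h6 : 1 / (2 * (n : ℝ)) ≤ 1 := by
    rw [div_le_one (by positivity)]
    have : (1 : ℝ) ≤ n := by exact_mod_cast hn
    linarith
  calc (1 / 2 : ℝ≥0∞) = ENNReal.ofReal (1 / 2) := by
        rw [ENNReal.ofReal_div_of_pos (by norm_num)]; simp
    _ ≤ ENNReal.ofReal ((1 + -(1 / (2 * n))) ^ n) := by
        refine ENNReal.ofReal_le_ofReal ?_
        -- Bernoulli's inequality: `(1 - 1 / (2n)) ^ n ≥ 1 - 1/2`.
        have h5 := one_add_mul_le_pow (a := -(1 / (2 * (n : ℝ)))) (by linarith) n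
        refine le_trans (le_of_eq ?_) h5
        field_simp
        norm_num
    _ = ENNReal.ofReal (1 + -(1 / (2 * n))) ^ n := ENNReal.ofReal_pow (by linarith) n
    _ ≤ ρ ^ n := pow_le_pow_left₀ zero_le h4 n

end SampleLaw

/-! ### Le Cam's bound on one bump and Assouad's hypercube -/

section Assouad

variable {d : ℕ}

lemma measurable_lintegral_enorm_sub_sq {n : ℕ} (μ : Measure (E d)) [SFinite μ]
    {fhat : (Fin n → E d × ℝ) → E d → ℝ} (hfhat : IsEstimator fhat) {h : E d → ℝ}
    (hh : Measurable h) : Measurable fun z => ∫⁻ x, ‖fhat z x - h x‖ₑ ^ 2 ∂μ :=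
  Measurable.lintegral_prod_right'
    (f := fun p : (Fin n → E d × ℝ) × E d => ‖fhat p.1 p.2 - h p.2‖ₑ ^ 2)
    ((Measurable.sub hfhat (hh.comp measurable_snd)).enorm.pow_const 2)

/-- Le Cam's two-point bound for the local risk on `B`, for regression functions at squared
distance `S` of order `σ² / n` which differ on `B` only. -/
lemma le_localRisk_add (μ : Measure (E d)) [IsProbabilityMeasure μ] {σ : ℝ≥0} (hσ : σ ≠ 0)
    {f g : E d → ℝ} (hf : Measurable f) (hg : Measurable g) {n : ℕ} (hn : 1 ≤ n)
    {S : ℝ≥0∞} (hS : S ≤ ENNReal.ofReal (4 * (σ : ℝ) ^ 2 / n)) {B : Set (E d)}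
    (hB : MeasurableSet B) (hfg : ∫⁻ x, ‖f x - g x‖ₑ ^ 2 ∂μ = S) (hoff : ∀ x ∉ B, f x = g x)
    {fhat : (Fin n → E d × ℝ) → E d → ℝ} (hfhat : IsEstimator fhat) :
    S / 8 ≤ ∫⁻ z, ∫⁻ x in B, ‖fhat z x - f x‖ₑ ^ 2 ∂μ
        ∂(Measure.pi fun _ : Fin n => sampleLaw μ σ f) +
      ∫⁻ z, ∫⁻ x in B, ‖fhat z x - g x‖ₑ ^ 2 ∂μ
        ∂(Measure.pi fun _ : Fin n => sampleLaw μ σ g) := by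
  have hmeas : ∀ {h : E d → ℝ}, Measurable h →
      Measurable fun z => ∫⁻ x in B, ‖fhat z x - h x‖ₑ ^ 2 ∂μ := by
    exact fun hh => measurable_lintegral_enorm_sub_sq _ hfhat hh
  have hdens : ∀ {h : E d → ℝ}, Measurable h →
      (Measure.pi fun _ : Fin n => sampleLaw μ σ h) =
        (Measure.pi fun _ : Fin n => μ.prod volume).withDensity
          (fun z => ∏ i, sampleDensity σ h (z i)) := by
    intro h hh
    have := isProbabilityMeasure_sampleLaw μ σ hh
    have he := sampleLaw_eq_withDensity μ hσ hh
    rw [he] at this ⊢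
    exact pi_withDensity _ _ (measurable_sampleDensity σ hh)
  have hdm : ∀ {h : E d → ℝ}, Measurable h →
      Measurable fun z : Fin n → E d × ℝ => ∏ i, sampleDensity σ h (z i) := fun hh =>
    Finset.measurable_prod _ fun i _ =>
      (measurable_sampleDensity σ hh).comp (measurable_pi_apply i)
  have hone : ∀ {h : E d → ℝ}, Measurable h →
      ∫⁻ z, ∏ i, sampleDensity σ h (z i) ∂(Measure.pi fun _ : Fin n => μ.prod volume) ≤ 1 := by
    intro h hh
    have := isProbabilityMeasure_sampleLaw μ σ hh
    rw [← setLIntegral_univ, ← withDensity_apply _ MeasurableSet.univ, ← hdens hh]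
    exact prob_le_one
  have hnorm : ∀ u : E d → ℝ,
      (∫⁻ x in B, ‖u x‖ₑ ^ 2 ∂μ) ^ (1 / 2 : ℝ) = eLpNorm u 2 (μ.restrict B) := by
    intro u
    rw [eLpNorm_eq_lintegral_rpow_enorm_toReal (by norm_num) (by norm_num)]
    norm_num
  have hSB : S ^ (1 / 2 : ℝ) = eLpNorm (fun x => f x - g x) 2 (μ.restrict B) := by
    rw [← hnorm, ← hfg, ← lintegral_indicator hB]
    congr 1
    refine lintegral_congr fun x => ?_
    by_cases hx : x ∈ B
    · rw [Set.indicator_of_mem hx]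
    · rw [Set.indicator_of_notMem hx, hoff x hx]; simp
  have htri : ∀ z, S ^ (1 / 2 : ℝ) ≤ (∫⁻ x in B, ‖fhat z x - f x‖ₑ ^ 2 ∂μ) ^ (1 / 2 : ℝ) +
      (∫⁻ x in B, ‖fhat z x - g x‖ₑ ^ 2 ∂μ) ^ (1 / 2 : ℝ) := by
    intro z
    have hz : Measurable (fhat z) := hfhat.comp measurable_prodMk_left
    rw [hSB, hnorm, hnorm, add_comm]
    have h := eLpNorm_sub_le (p := 2) (μ := μ.restrict B)
      (hz.sub hg).aestronglyMeasurable (hz.sub hf).aestronglyMeasurable (by norm_num)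
    refine le_trans (le_of_eq ?_) h
    congr 1
    ext x
    simp
  have h := sq_mul_affinity_le (Measure.pi fun _ : Fin n => μ.prod volume) (hdm hf) (hdm hg)
    (hmeas hf) (hmeas hg) (hone hf) (hone hg) _ htri
  rw [hdens hf, hdens hg, lintegral_withDensity_eq_lintegral_mul _ (hdm hf) (hmeas hf),
    lintegral_withDensity_eq_lintegral_mul _ (hdm hg) (hmeas hg)]
  have haff := half_le_affinity_pow μ hσ hf hg hn (hfg.trans_le hS)
  -- Separation `√S` and affinity at least `1/2` give `S / 4`; the factor `2` of the two-point bound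
  -- leaves `S / 8`.
  have h4 : (S ^ (1 / 2 : ℝ) * (1 / 2)) ^ 2 = 2 * (S / 8) := by
    rw [mul_pow, ← ENNReal.rpow_two, ← ENNReal.rpow_mul]
    norm_num only [ENNReal.rpow_one]
    rw [div_eq_mul_inv S, mul_left_comm 2 S]
    congr 1
    have h8 : (8 : ℝ≥0∞) = 2 * 2 ^ 2 := by norm_num
    rw [h8, ENNReal.mul_inv (by norm_num) (by norm_num), ← mul_assoc,
      ENNReal.mul_inv_cancel (by norm_num) (by norm_num), one_mul, one_div, ENNReal.inv_pow]
  have h5 : 2 * (S / 8) ≤ _ := h4.symm.trans_le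
    ((pow_le_pow_left₀ zero_le (mul_le_mul_right haff _) 2).trans h)
  exact (ENNReal.mul_le_mul_iff_right (by norm_num) (by norm_num)).1 h5

/-- Assouad's bound for the hypercube of functions spanned by bumps with disjoint supports. -/
theorem card_mul_le_minimaxRisk (μ : Measure (E d)) [IsProbabilityMeasure μ] {σ : ℝ≥0}
    (hσ : σ ≠ 0) {F : Set (E d → ℝ)} {n : ℕ} (hn : 1 ≤ n) {ι : Type*} [Fintype ι]
    {g : ι → E d → ℝ} (hg : ∀ j, Measurable (g j)) {B : ι → Set (E d)}
    (hB : ∀ j, MeasurableSet (B j)) (hdisj : Pairwise (Function.onFun Disjoint B))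
    (hoff : ∀ j, ∀ x ∉ B j, g j x = 0) {S : ℝ≥0∞} (hgS : ∀ j, ∫⁻ x, ‖g j x‖ₑ ^ 2 ∂μ = S)
    (hS : S ≤ ENNReal.ofReal (4 * (σ : ℝ) ^ 2 / n))
    (hF : ∀ ε : ι → Bool, (fun x => ∑ j, if ε j then g j x else 0) ∈ F) :
    Fintype.card ι * (S / 16) ≤ minimaxRisk μ σ F n := by
  classical
  refine le_iInf₂ fun fhat hfhat => ?_
  set f : (ι → Bool) → E d → ℝ := fun ε x => ∑ j, if ε j then g j x else 0 with hfdef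
  have hf : ∀ ε, Measurable (f ε) := fun ε => Finset.measurable_sum _ fun j _ => by
    by_cases h : ε j <;> simp [h, hg j]
  set R : (ι → Bool) → ι → ℝ≥0∞ := fun ε j => ∫⁻ z, ∫⁻ x in B j, ‖fhat z x - f ε x‖ₑ ^ 2 ∂μ
        ∂(Measure.pi fun _ : Fin n => sampleLaw μ σ (f ε)) with hR
  -- The sets `B j` are disjoint, so the local risks add up to at most the full risk.
  have hrisk : ∀ ε, ∑ j, R ε j ≤ risk μ σ fhat (f ε) := by
    intro ε
    rw [hR, risk, ← lintegral_finsetSum]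
    · refine lintegral_mono fun z => ?_
      have h2 : eLpNorm (fun x => fhat z x - f ε x) 2 μ ^ 2 =
          ∫⁻ x, ‖fhat z x - f ε x‖ₑ ^ 2 ∂μ := by
        rw [eLpNorm_eq_lintegral_rpow_enorm_toReal (by norm_num) (by norm_num),
          ← ENNReal.rpow_two, ← ENNReal.rpow_mul]
        norm_num
      rw [h2, ← tsum_fintype (L := .unconditional _), ← lintegral_iUnion hB hdisj]
      exact setLIntegral_le_lintegral _ _
    · intro j _
      exact measurable_lintegral_enorm_sub_sq _ hfhat (hf ε)
  let flip (j : ι) (ε : ι → Bool) : ι → Bool := Function.update ε j (!ε j)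
  have hflip : ∀ j, Function.Involutive (flip j) := fun j ε => by simp [flip]
  have hdiff : ∀ ε j x, f ε x - f (flip j ε) x = if ε j then g j x else - g j x := by
    intro ε j x
    simp only [hfdef]
    rw [← Finset.sum_sub_distrib, Finset.sum_eq_single j]
    · by_cases h : ε j <;> simp [flip, h]
    · intro i _ hi
      simp [flip, Function.update_of_ne hi]
    · simp
  have hpair : ∀ ε j, S / 8 ≤ R ε j + R (flip j ε) j := by
    intro ε j
    refine le_localRisk_add μ hσ (hf ε) (hf _) hn hS (hB j) ?_ ?_ hfhat
    · rw [← hgS j]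
      refine lintegral_congr fun x => ?_
      rw [hdiff]
      by_cases h : ε j <;> simp [h]
    · intro x hx
      rw [← sub_eq_zero, hdiff, hoff j x hx]
      simp
  set M := ⨆ f ∈ F, risk μ σ fhat f
  have hM : ∀ ε, ∑ j, R ε j ≤ M := fun ε =>
    (hrisk ε).trans (le_iSup₂ (f := fun f (_ : f ∈ F) => risk μ σ fhat f) (f ε) (hF ε))
  set N : ℝ≥0∞ := ((Fintype.card (ι → Bool) : ℕ) : ℝ≥0∞)
  -- Pair each vertex with its neighbour in direction `j`. As `flip j` permutes the vertices, both
  -- halves have the same sum.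
  have hsum : ∀ j, N * (S / 8) ≤ 2 * ∑ ε, R ε j := by
    intro j
    calc N * (S / 8) = ∑ _ε : ι → Bool, S / 8 := by simp [N]
      _ ≤ ∑ ε, (R ε j + R (flip j ε) j) := Finset.sum_le_sum fun ε _ => hpair ε j
      _ = 2 * ∑ ε, R ε j := by
        rw [Finset.sum_add_distrib, two_mul]
        exact congrArg _ (Equiv.sum_comp (hflip j).toPerm fun ε => R ε j)
  have htot : N * (Fintype.card ι * (S / 8)) ≤ N * (2 * M) := by
    calc N * (Fintype.card ι * (S / 8)) = ∑ _j : ι, N * (S / 8) := by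
          simp [mul_left_comm]
      _ ≤ ∑ j, 2 * ∑ ε, R ε j := Finset.sum_le_sum fun j _ => hsum j
      _ = 2 * ∑ ε, ∑ j, R ε j := by rw [← Finset.mul_sum, Finset.sum_comm]
      _ ≤ 2 * ∑ _ε : ι → Bool, M := by gcongr with ε; exact hM ε
      _ = N * (2 * M) := by simp [N, mul_left_comm]
  have hN0 : N ≠ 0 := by simp [N]
  have hN1 : N ≠ ⊤ := by simp [N]
  have h1 := (ENNReal.mul_le_mul_iff_right hN0 hN1).1 htot
  have h2 : (Fintype.card ι : ℝ≥0∞) * (S / 8) = 2 * (Fintype.card ι * (S / 16)) := by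
    have h16 : (16 : ℝ≥0∞) = 2 * 8 := by norm_num
    rw [h16, mul_left_comm, div_eq_mul_inv, div_eq_mul_inv, ENNReal.mul_inv (by norm_num)
      (by norm_num), mul_left_comm 2 S, ← mul_assoc 2 2⁻¹,
      ENNReal.mul_inv_cancel (by norm_num) (by norm_num), one_mul]
  rw [h2] at h1
  exact (ENNReal.mul_le_mul_iff_right (by norm_num) (by norm_num)).1 h1

end Assouad

/-! ### Classical derivatives as weak derivatives -/

section WeakDerivative

variable {d : ℕ}

/-- The mixed derivative with the directions in the reverse order of `multiDeriv`. -/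
noncomputable def revMultiDeriv {d : ℕ} (β : Fin d → ℕ) (f : E d → ℝ) : E d → ℝ :=
  (List.finRange d).foldl (fun ψ i => (pderiv i)^[β i] ψ) f

lemma contDiff_pderiv (i : Fin d) {f : E d → ℝ} (hf : ContDiff ℝ ∞ f) :
    ContDiff ℝ ∞ (pderiv i f) :=
  (hf.fderiv_right (m := ∞) (by simp)).clm_apply contDiff_const

lemma tsupport_pderiv_subset (i : Fin d) (f : E d → ℝ) : tsupport (pderiv i f) ⊆ tsupport f := by
  refine closure_minimal (fun x hx => support_fderiv_subset ℝ (f := f) fun h => hx ?_)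
    (isClosed_tsupport f)
  simp [pderiv, h]

lemma iterate_pderiv_invariant {P : (E d → ℝ) → Prop} (i : Fin d)
    (hP : ∀ f, P f → P (pderiv i f)) (k : ℕ) {f : E d → ℝ} (hf : P f) :
    P ((pderiv i)^[k] f) := by
  induction k with
  | zero => exact hf
  | succ k ih => rw [Function.iterate_succ_apply']; exact hP _ ih

lemma foldl_pderiv_invariant {P : (E d → ℝ) → Prop} (hP : ∀ i f, P f → P (pderiv i f))
    (β : Fin d → ℕ) (l : List (Fin d)) {f : E d → ℝ} (hf : P f) :
    P (l.foldl (fun ψ i => (pderiv i)^[β i] ψ) f) := by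
  induction l generalizing f with
  | nil => exact hf
  | cons i l ih => exact ih (iterate_pderiv_invariant i (hP i) _ hf)

lemma foldr_pderiv_invariant {P : (E d → ℝ) → Prop} (hP : ∀ i f, P f → P (pderiv i f))
    (β : Fin d → ℕ) (l : List (Fin d)) {f : E d → ℝ} (hf : P f) :
    P (l.foldr (fun i ψ => (pderiv i)^[β i] ψ) f) := by
  induction l with
  | nil => exact hf
  | cons i l ih => exact iterate_pderiv_invariant i (hP i) _ ih

/-- Smooth functions with compact support are stable under partial derivatives. -/
lemma contDiff_hasCompactSupport_pderiv (i : Fin d) (f : E d → ℝ)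
    (hf : ContDiff ℝ ∞ f ∧ HasCompactSupport f) :
    ContDiff ℝ ∞ (pderiv i f) ∧ HasCompactSupport (pderiv i f) :=
  ⟨contDiff_pderiv i hf.1, hf.2.of_isClosed_subset (isClosed_tsupport _)
    (tsupport_pderiv_subset i f)⟩

lemma integral_mul_pderiv (i : Fin d) {f φ : E d → ℝ} (hf : ContDiff ℝ ∞ f)
    (hφ : ContDiff ℝ ∞ φ ∧ HasCompactSupport φ) :
    ∫ x, f x * pderiv i φ x = -∫ x, pderiv i f x * φ x := by
  have hφ' := contDiff_hasCompactSupport_pderiv i φ hφ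
  refine integral_mul_fderiv_eq_neg_fderiv_mul_of_integrable ?_ ?_ ?_
    (fun x _ => (hf.differentiable (by simp)).differentiableAt)
    (fun x _ => (hφ.1.differentiable (by simp)).differentiableAt)
  · exact ((contDiff_pderiv i hf).continuous.mul hφ.1.continuous).integrable_of_hasCompactSupport
      hφ.2.mul_left
  · exact (hf.continuous.mul hφ'.1.continuous).integrable_of_hasCompactSupport hφ'.2.mul_left
  · exact (hf.continuous.mul hφ.1.continuous).integrable_of_hasCompactSupport hφ.2.mul_left

lemma integral_mul_iterate_pderiv (i : Fin d) (k : ℕ) {f φ : E d → ℝ} (hf : ContDiff ℝ ∞ f)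
    (hφ : ContDiff ℝ ∞ φ ∧ HasCompactSupport φ) :
    ∫ x, f x * (pderiv i)^[k] φ x = (-1) ^ k * ∫ x, (pderiv i)^[k] f x * φ x := by
  induction k generalizing f with
  | zero => simp
  | succ k ih =>
    rw [Function.iterate_succ_apply', Function.iterate_succ_apply, integral_mul_pderiv i hf
      (iterate_pderiv_invariant i (contDiff_hasCompactSupport_pderiv i) k hφ),
      ih (contDiff_pderiv i hf)]
    ring

/-- Integration by parts removes the outermost derivative of `φ` first and makes it the innermost
one on `f`. Accepting the reversed order, `foldr` against `foldl`, avoids commuting partial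
derivatives. -/
lemma integral_mul_foldr_pderiv (β : Fin d → ℕ) (l : List (Fin d)) {f φ : E d → ℝ}
    (hf : ContDiff ℝ ∞ f) (hφ : ContDiff ℝ ∞ φ ∧ HasCompactSupport φ) :
    ∫ x, f x * l.foldr (fun i ψ => (pderiv i)^[β i] ψ) φ x =
      (-1) ^ (l.map β).sum * ∫ x, l.foldl (fun ψ i => (pderiv i)^[β i] ψ) f x * φ x := by
  induction l generalizing f with
  | nil => simp
  | cons i l ih =>
    rw [List.foldr_cons, List.foldl_cons, integral_mul_iterate_pderiv i _ hf
      (foldr_pderiv_invariant contDiff_hasCompactSupport_pderiv β l hφ),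
      ih (iterate_pderiv_invariant (P := ContDiff ℝ ∞) i (fun _ => contDiff_pderiv i) _ hf),
      List.map_cons,
      List.sum_cons, pow_add, mul_assoc]

/-- Classical derivatives of smooth functions are weak derivatives. -/
lemma isWeakDeriv_revMultiDeriv (β : Fin d → ℕ) {f : E d → ℝ} (hf : ContDiff ℝ ∞ f) :
    IsWeakDeriv β f (revMultiDeriv β f) := by
  have hd : ContDiff ℝ ∞ (revMultiDeriv β f) :=
    foldl_pderiv_invariant (fun i f => contDiff_pderiv i) β _ hf
  refine ⟨hf.continuous.locallyIntegrable, hd.continuous.locallyIntegrable, fun φ hφ hc => ?_⟩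
  rw [Fin.sum_univ_def]
  exact integral_mul_foldr_pderiv β _ hf ⟨hφ, hc⟩

end WeakDerivative

/-! ### Sobolev norms of separated bumps -/

section BumpSum

variable {d : ℕ} {ι : Type*} [Fintype ι]

/-- The superposition of dilated translates of `ψ`, with coefficients `c`. -/
noncomputable def bumpSum (c : ι → ℝ) (r : ℝ) (p : ι → E d) (ψ : E d → ℝ) (x : E d) : ℝ :=
  ∑ j, c j * ψ (r • (x - p j))

lemma contDiff_bumpSum (c : ι → ℝ) (r : ℝ) (p : ι → E d) {ψ : E d → ℝ} (hψ : ContDiff ℝ ∞ ψ) :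
    ContDiff ℝ ∞ (bumpSum c r p ψ) :=
  ContDiff.sum fun _ _ => contDiff_const.mul
    (hψ.comp ((contDiff_id.sub contDiff_const).const_smul r))

/-- By the chain rule these superpositions are closed under differentiation, so bounds for a general
profile apply to every derivative. -/
lemma pderiv_bumpSum (i : Fin d) (c : ι → ℝ) (r : ℝ) (p : ι → E d) {ψ : E d → ℝ}
    (hψ : ContDiff ℝ ∞ ψ) : pderiv i (bumpSum c r p ψ) = bumpSum (r • c) r p (pderiv i ψ) := by
  ext x
  have hd : ∀ j, HasFDerivAt (fun x => c j * ψ (r • (x - p j)))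
      (c j • (fderiv ℝ ψ (r • (x - p j))).comp (r • ContinuousLinearMap.id ℝ (E d))) x := by
    intro j
    have h1 : HasFDerivAt (fun x : E d => r • (x - p j)) (r • ContinuousLinearMap.id ℝ (E d)) x :=
      ((hasFDerivAt_id x).sub_const (p j)).const_smul r
    exact (((hψ.differentiable (by simp)).differentiableAt.hasFDerivAt).comp x h1).const_mul (c j)
  have hs := HasFDerivAt.fun_sum (u := Finset.univ) fun j _ => hd j
  simp only [pderiv, bumpSum]
  rw [show bumpSum c r p ψ = fun x => ∑ j, c j * ψ (r • (x - p j)) from rfl, hs.fderiv]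
  simp only [FunLike.coe_sum, Finset.sum_apply, smul_apply,
    ContinuousLinearMap.comp_apply, ContinuousLinearMap.id_apply, map_smul, smul_eq_mul,
    Pi.smul_apply]
  exact Finset.sum_congr rfl fun j _ => by ring

lemma iterate_pderiv_bumpSum (i : Fin d) (k : ℕ) (c : ι → ℝ) (r : ℝ) (p : ι → E d) {ψ : E d → ℝ}
    (hψ : ContDiff ℝ ∞ ψ) :
    (pderiv i)^[k] (bumpSum c r p ψ) = bumpSum (r ^ k • c) r p ((pderiv i)^[k] ψ) := by
  induction k with
  | zero => simp
  | succ k ih =>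
    rw [Function.iterate_succ_apply', ih, pderiv_bumpSum i _ r p
      (iterate_pderiv_invariant (P := ContDiff ℝ ∞) i (fun _ => contDiff_pderiv i) k hψ),
      smul_smul, ← pow_succ',
      Function.iterate_succ_apply']

lemma foldl_pderiv_bumpSum (β : Fin d → ℕ) (l : List (Fin d)) (c : ι → ℝ) (r : ℝ) (p : ι → E d)
    {ψ : E d → ℝ} (hψ : ContDiff ℝ ∞ ψ) :
    l.foldl (fun ψ i => (pderiv i)^[β i] ψ) (bumpSum c r p ψ) =
      bumpSum (r ^ (l.map β).sum • c) r p (l.foldl (fun ψ i => (pderiv i)^[β i] ψ) ψ) := by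
  induction l generalizing c ψ with
  | nil => simp
  | cons i l ih =>
    rw [List.foldl_cons, iterate_pderiv_bumpSum i _ c r p hψ,
      ih _ (iterate_pderiv_invariant (P := ContDiff ℝ ∞) i (fun _ => contDiff_pderiv i) _ hψ),
      List.foldl_cons,
      smul_smul, ← pow_add, add_comm, List.map_cons, List.sum_cons]

lemma revMultiDeriv_bumpSum (β : Fin d → ℕ) (c : ι → ℝ) (r : ℝ) (p : ι → E d)
    {ψ : E d → ℝ} (hψ : ContDiff ℝ ∞ ψ) :
    revMultiDeriv β (bumpSum c r p ψ) =
      bumpSum (r ^ (∑ i, β i) • c) r p (revMultiDeriv β ψ) := by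
  rw [Fin.sum_univ_def]
  exact foldl_pderiv_bumpSum β _ c r p hψ

/-- At most one summand of a separated superposition is active at a given point. -/
lemma exists_finset_card_le_one {r : ℝ} (hr : 0 < r) {p : ι → E d}
    (hp : ∀ i j, i ≠ j → 2 / r < dist (p i) (p j)) {ψ : E d → ℝ}
    (hψ : tsupport ψ ⊆ Metric.closedBall 0 1) (x : E d) :
    ∃ s : Finset ι, s.card ≤ 1 ∧ ∀ j ∉ s, ψ (r • (x - p j)) = 0 := by
  classical
  refine ⟨Finset.univ.filter fun j => ψ (r • (x - p j)) ≠ 0, ?_, by simp⟩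
  -- Two bumps active at `x` would have centres within `2 / r` of each other.
  have hmem : ∀ j, ψ (r • (x - p j)) ≠ 0 → dist x (p j) ≤ 1 / r := by
    intro j hj
    have h := hψ (subset_tsupport ψ hj)
    rw [mem_closedBall_zero_iff, norm_smul, Real.norm_of_nonneg hr.le] at h
    rw [dist_eq_norm, le_div_iff₀ hr]
    linarith
  rw [Finset.card_le_one]
  intro i hi j hj
  by_contra hij
  have h1 := hmem i (Finset.mem_filter.1 hi).2
  have h2 := hmem j (Finset.mem_filter.1 hj).2
  have h3 := hp i j hij
  have h4 := dist_triangle_left (p i) (p j) x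
  have h5 : 2 / r = 1 / r + 1 / r := by ring
  linarith

lemma abs_bumpSum_le {r : ℝ} (hr : 0 < r) {p : ι → E d}
    (hp : ∀ i j, i ≠ j → 2 / r < dist (p i) (p j)) {ψ : E d → ℝ}
    (hψ : tsupport ψ ⊆ Metric.closedBall 0 1) {c : ι → ℝ} {K M : ℝ} (hc : ∀ j, |c j| ≤ K)
    (hK : 0 ≤ K) (hM : ∀ x, |ψ x| ≤ M) (x : E d) : |bumpSum c r p ψ x| ≤ K * M := by
  obtain ⟨s, hs, h0⟩ := exists_finset_card_le_one hr hp hψ x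
  have hM0 : 0 ≤ M := (abs_nonneg _).trans (hM 0)
  rw [bumpSum, ← Finset.sum_subset (Finset.subset_univ s) fun j _ hj => by rw [h0 j hj, mul_zero]]
  calc |∑ j ∈ s, c j * ψ (r • (x - p j))| ≤ ∑ j ∈ s, |c j * ψ (r • (x - p j))| :=
        Finset.abs_sum_le_sum_abs _ _
    _ ≤ ∑ _j ∈ s, K * M := Finset.sum_le_sum fun j _ => by
        rw [abs_mul]
        exact mul_le_mul (hc j) (hM _) (abs_nonneg _) hK
    _ = s.card * (K * M) := by simp
    _ ≤ 1 * (K * M) := by gcongr; exact_mod_cast hs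
    _ = K * M := one_mul _

/-- At most one bump is active at `x` and one at `y`, so at most two terms survive, whatever the
size of `ι`. The dilation contributes `r ^ θ`. -/
lemma abs_bumpSum_sub_le {r : ℝ} (hr : 0 < r) {p : ι → E d}
    (hp : ∀ i j, i ≠ j → 2 / r < dist (p i) (p j)) {ψ : E d → ℝ}
    (hψ : tsupport ψ ⊆ Metric.closedBall 0 1) {c : ι → ℝ} {K H θ : ℝ} (hc : ∀ j, |c j| ≤ K)
    (hK : 0 ≤ K) (hH0 : 0 ≤ H) (hH : ∀ x y, |ψ x - ψ y| ≤ H * ‖x - y‖ ^ θ) (x y : E d) :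
    |bumpSum c r p ψ x - bumpSum c r p ψ y| ≤ 2 * (K * r ^ θ * H) * ‖x - y‖ ^ θ := by
  classical
  obtain ⟨s, hs, h0⟩ := exists_finset_card_le_one hr hp hψ x
  obtain ⟨t, ht, h0'⟩ := exists_finset_card_le_one hr hp hψ y
  rw [bumpSum, bumpSum, ← Finset.sum_sub_distrib, ← Finset.sum_subset
    (Finset.subset_univ (s ∪ t)) fun j _ hj => by
      rw [Finset.mem_union, not_or] at hj
      rw [h0 j hj.1, h0' j hj.2, mul_zero, sub_zero]]
  have hterm : ∀ j, |c j * ψ (r • (x - p j)) - c j * ψ (r • (y - p j))| ≤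
      K * r ^ θ * H * ‖x - y‖ ^ θ := by
    intro j
    have h1 := hH (r • (x - p j)) (r • (y - p j))
    rw [← smul_sub, sub_sub_sub_cancel_right, norm_smul, Real.norm_of_nonneg hr.le,
      Real.mul_rpow hr.le (norm_nonneg _)] at h1
    rw [← mul_sub, abs_mul]
    calc _ ≤ K * (H * (r ^ θ * ‖x - y‖ ^ θ)) := mul_le_mul (hc j) h1 (abs_nonneg _) hK
      _ = _ := by ring
  have hnn : 0 ≤ K * r ^ θ * H * ‖x - y‖ ^ θ := by positivity
  calc _ ≤ ∑ j ∈ s ∪ t, |c j * ψ (r • (x - p j)) - c j * ψ (r • (y - p j))| :=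
        Finset.abs_sum_le_sum_abs _ _
    _ ≤ ∑ _j ∈ s ∪ t, K * r ^ θ * H * ‖x - y‖ ^ θ := Finset.sum_le_sum fun j _ => hterm j
    _ = (s ∪ t).card * (K * r ^ θ * H * ‖x - y‖ ^ θ) := by simp
    _ ≤ 2 * (K * r ^ θ * H * ‖x - y‖ ^ θ) := by
        gcongr
        exact_mod_cast (Finset.card_union_le s t).trans (add_le_add hs ht)
    _ = _ := by ring

/-- Lipschitz functions with compact support are Hölder continuous. -/
lemma exists_holder_bound {ψ : E d → ℝ} (hψ : ContDiff ℝ ∞ ψ) (hc : HasCompactSupport ψ) {θ : ℝ}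
    (h0 : 0 ≤ θ) (h1 : θ ≤ 1) : ∃ H, 0 ≤ H ∧ ∀ x y, |ψ x - ψ y| ≤ H * ‖x - y‖ ^ θ := by
  obtain ⟨L, hL⟩ := hψ.lipschitzWith_of_hasCompactSupport hc (by simp)
  obtain ⟨M, hM⟩ := hc.exists_bound_of_continuous hψ.continuous
  have hM0 : 0 ≤ M := (norm_nonneg _).trans (hM 0)
  -- `L` serves for `‖x - y‖ ≤ 1` and `2 * M` for larger distances.
  refine ⟨2 * M + L, by positivity, fun x y => ?_⟩
  have hl : |ψ x - ψ y| ≤ L * ‖x - y‖ := by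
    have := hL.dist_le_mul x y
    rwa [Real.dist_eq, dist_eq_norm] at this
  have hm : |ψ x - ψ y| ≤ 2 * M := by
    have h2 := abs_sub (ψ x) (ψ y)
    have h3 := hM x
    have h4 := hM y
    rw [Real.norm_eq_abs] at h3 h4
    linarith
  rcases le_total ‖x - y‖ 1 with h | h
  · have : ‖x - y‖ ≤ ‖x - y‖ ^ θ := by
      simpa using Real.rpow_le_rpow_of_exponent_ge' (norm_nonneg _) h h0 h1
    have h2 : L * ‖x - y‖ ≤ L * ‖x - y‖ ^ θ := by gcongr
    have h3 : 0 ≤ 2 * M * ‖x - y‖ ^ θ := by positivity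
    linarith
  · have : 1 ≤ ‖x - y‖ ^ θ := Real.one_le_rpow h h0
    nlinarith [L.coe_nonneg, mul_nonneg (add_nonneg (mul_nonneg zero_le_two hM0) L.coe_nonneg)
      (sub_nonneg.2 this)]

lemma revMultiDeriv_bump (β : Fin d → ℕ) {φ : E d → ℝ} (hφ : ContDiff ℝ ∞ φ)
    (hs : tsupport φ ⊆ Metric.closedBall 0 1) :
    ContDiff ℝ ∞ (revMultiDeriv β φ) ∧ tsupport (revMultiDeriv β φ) ⊆ Metric.closedBall 0 1 :=
  foldl_pderiv_invariant (P := fun f => ContDiff ℝ ∞ f ∧ tsupport f ⊆ Metric.closedBall 0 1)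
    (fun i f hf => ⟨contDiff_pderiv i hf.1, (tsupport_pderiv_subset i f).trans hf.2⟩) β _ ⟨hφ, hs⟩

/-- The Sobolev norm of a separated superposition is controlled by its profile, with the natural
scaling in the dilation. -/
lemma exists_sobolevNorm_bumpSum_le {α : ℝ} (hα : 0 < α) {φ : E d → ℝ} (hφ : ContDiff ℝ ∞ φ)
    (hs : tsupport φ ⊆ Metric.closedBall 0 1) :
    ∃ C : ℝ≥0∞, C ≠ ⊤ ∧ ∀ {ι : Type} [Fintype ι] {r : ℝ} {p : ι → E d} {c : ι → ℝ} {K : ℝ},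
      1 ≤ r → (∀ i j, i ≠ j → 2 / r < dist (p i) (p j)) → (∀ j, |c j| ≤ K) → 0 ≤ K →
        sobolevNorm α ⊤ (bumpSum c r p φ) ≤ C * ENNReal.ofReal (K * r ^ α) := by
  have hk : (⌊α⌋₊ : ℝ) ≤ α := Nat.floor_le hα.le
  have hk1 : α < ⌊α⌋₊ + 1 := Nat.lt_floor_add_one α
  have hcs : ∀ β, HasCompactSupport (revMultiDeriv β φ) := fun β =>
    (isCompact_closedBall 0 1).of_isClosed_subset (isClosed_tsupport _)
      (revMultiDeriv_bump β hφ hs).2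
  choose M hM using fun β : Fin d → ℕ => (hcs β).exists_bound_of_continuous
    (revMultiDeriv_bump β hφ hs).1.continuous
  choose H hH0 hH using fun β : Fin d → ℕ => exists_holder_bound (revMultiDeriv_bump β hφ hs).1
    (hcs β) (θ := α - ⌊α⌋₊) (by linarith) (by linarith)
  refine ⟨(∑ j ∈ Finset.range (⌊α⌋₊ + 1),
      ∑ β ∈ Finset.piAntidiag (Finset.univ : Finset (Fin d)) j, ENNReal.ofReal (M β)) +
    ∑ β ∈ Finset.piAntidiag (Finset.univ : Finset (Fin d)) ⌊α⌋₊, ENNReal.ofReal (2 * H β),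
    by simp [ENNReal.sum_eq_top, ENNReal.mul_eq_top], ?_⟩
  intro ι _ r p c K hr hp hc hK
  have hr0 : 0 < r := by linarith
  -- The norm is an infimum over families of weak derivatives, so the classical family bounds it.
  refine (iInf₂_le (fun β => revMultiDeriv β (bumpSum c r p φ)) fun β _ =>
    isWeakDeriv_revMultiDeriv β (contDiff_bumpSum c r p hφ)).trans ?_
  simp only [sobolevSum, revMultiDeriv_bumpSum _ c r p hφ]
  have hcoef : ∀ (j : ℕ) (i : ι), |(r ^ j • c) i| ≤ K * r ^ j := by
    intro j i
    rw [Pi.smul_apply, smul_eq_mul, abs_mul, abs_of_nonneg (by positivity), mul_comm]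
    exact mul_le_mul_of_nonneg_right (hc i) (by positivity)
  rw [add_mul, Finset.sum_mul, Finset.sum_mul]
  refine add_le_add (Finset.sum_le_sum fun j hj => ?_) ?_
  · rw [Finset.sum_mul]
    refine Finset.sum_le_sum fun β hβ => ?_
    have hβ' : ∑ i, β i = j := (Finset.mem_piAntidiag.1 hβ).1
    have hM0 : 0 ≤ M β := (norm_nonneg _).trans (hM β 0)
    rw [eLpNorm_exponent_top, hβ', ← ENNReal.ofReal_mul hM0]
    refine eLpNormEssSup_le_of_ae_bound (ae_of_all _ fun x => ?_)
    refine (abs_bumpSum_le hr0 hp (revMultiDeriv_bump β hφ hs).2 (hcoef j) (by positivity)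
      (hM β) x).trans ?_
    rw [mul_comm]
    refine mul_le_mul_of_nonneg_left (mul_le_mul_of_nonneg_left ?_ hK) hM0
    rw [← Real.rpow_natCast]
    -- Here `1 ≤ r` is essential: every order `j ≤ ⌊α⌋₊` is absorbed by `r ^ α`.
    refine Real.rpow_le_rpow_of_exponent_le hr (le_trans ?_ hk)
    exact_mod_cast Nat.lt_succ_iff.1 (Finset.mem_range.1 hj)
  · split_ifs with hint
    · exact zero_le
    · refine Finset.sum_le_sum fun β hβ => ?_
      have hβ' : ∑ i, β i = ⌊α⌋₊ := (Finset.mem_piAntidiag.1 hβ).1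
      have hH0' := hH0 β
      rw [slobodeckijSeminorm, eLpNorm_exponent_top, hβ', ← ENNReal.ofReal_mul (by positivity)]
      refine eLpNormEssSup_le_of_ae_bound (ae_of_all _ fun z => ?_)
      have h := abs_bumpSum_sub_le hr0 hp (revMultiDeriv_bump β hφ hs).2 (hcoef ⌊α⌋₊)
        (by positivity) (hH0 β) (hH β) z.1 z.2
      have hrpow : r ^ ⌊α⌋₊ * r ^ (α - ⌊α⌋₊) = r ^ α := by
        rw [← Real.rpow_natCast, ← Real.rpow_add hr0]
        congr 1
        ring
      simp only [ENNReal.inv_top, ENNReal.toReal_zero, mul_zero, zero_add]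
      rw [norm_div, Real.norm_eq_abs, Real.norm_of_nonneg (by positivity)]
      refine div_le_of_le_mul₀ (by positivity) (by positivity) (h.trans_eq ?_)
      rw [← hrpow]
      ring

end BumpSum

/-! ### Centres of the bumps -/

section Grid

variable {d m : ℕ}

/-- A grid of mesh `1 / (m d)` in the unit ball. -/
noncomputable def gridPoint (d m : ℕ) (j : Fin d → Fin m) : E d :=
  WithLp.toLp 2 fun i => (j i : ℝ) / (m * d)

/-- Some coordinate differs by at least `1 / (md)`. The `3` makes the separation strict, so closed
balls of radius `1 / (3md)` are disjoint. -/
lemma lt_dist_gridPoint (hd : 1 ≤ d) (hm : 1 ≤ m) {i j : Fin d → Fin m} (hij : i ≠ j) :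
    2 / (3 * (m * d : ℝ)) < dist (gridPoint d m i) (gridPoint d m j) := by
  obtain ⟨k, hk⟩ := Function.ne_iff.1 hij
  have hmd : (0 : ℝ) < m * d := by
    have h1 : (0 : ℝ) < m := by exact_mod_cast hm
    have h2 : (0 : ℝ) < d := by exact_mod_cast hd
    positivity
  have h := PiLp.norm_apply_le (gridPoint d m i - gridPoint d m j) k
  rw [dist_eq_norm]
  refine lt_of_lt_of_le ?_ h
  have h1 : (gridPoint d m i - gridPoint d m j) k =
      (((i k : ℕ) : ℝ) - ((j k : ℕ) : ℝ)) / (m * d) := by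
    simp [gridPoint, sub_div]
  have h2 : (1 : ℝ) ≤ |((i k : ℕ) : ℝ) - ((j k : ℕ) : ℝ)| := by
    have : ((i k : ℕ) : ℤ) - ((j k : ℕ) : ℤ) ≠ 0 := by
      rw [sub_ne_zero]
      exact_mod_cast fun h => hk (Fin.ext h)
    exact_mod_cast Int.one_le_abs this
  rw [h1, Real.norm_eq_abs, abs_div, abs_of_pos hmd]
  calc 2 / (3 * (m * d : ℝ)) < 1 / (m * d) := by
        rw [div_lt_div_iff₀ (by positivity) hmd]; linarith
    _ ≤ _ := by gcongr

/-- Coordinates are at most `(m - 1) / (md)`, so the centre has norm at most `1 - 1 / m`, leaving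
room for the radius. -/
lemma closedBall_gridPoint_subset (hd : 1 ≤ d) (hm : 1 ≤ m) (j : Fin d → Fin m) :
    Metric.closedBall (gridPoint d m j) (1 / (3 * (m * d : ℝ))) ⊆ Metric.closedBall 0 1 := by
  have h1 : (1 : ℝ) ≤ m := by exact_mod_cast hm
  have h2 : (1 : ℝ) ≤ d := by exact_mod_cast hd
  have hm0 : (0 : ℝ) < m := by linarith
  have hd0 : (0 : ℝ) < d := by linarith
  have hn : ‖gridPoint d m j‖ ≤ (m - 1) / m := by
    refine (pow_le_pow_iff_left₀ (norm_nonneg _) (div_nonneg (by linarith) hm0.le) two_ne_zero).1 ?_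
    rw [EuclideanSpace.real_norm_sq_eq]
    calc ∑ i, (gridPoint d m j) i ^ 2 ≤ ∑ _i : Fin d, ((m - 1) / m : ℝ) ^ 2 * (1 / d ^ 2) := by
          refine Finset.sum_le_sum fun i _ => ?_
          have hj : ((j i : ℕ) : ℝ) ≤ m - 1 := by
            rw [le_sub_iff_add_le]
            exact_mod_cast (j i).2
          have : (gridPoint d m j) i = (j i : ℝ) / m * (1 / d) := by
            simp only [gridPoint]
            field_simp
          rw [this, mul_pow, div_pow 1, one_pow]
          gcongr
      _ = ((m - 1) / m : ℝ) ^ 2 * (1 / d) := by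
          simp only [Finset.sum_const, Finset.card_univ, Fintype.card_fin, nsmul_eq_mul]
          field_simp
      _ ≤ ((m - 1) / m : ℝ) ^ 2 * 1 := by
          gcongr
          rw [div_le_one hd0]
          exact h2
      _ = _ := mul_one _
  intro x hx
  rw [Metric.mem_closedBall, dist_eq_norm] at hx
  rw [mem_closedBall_zero_iff]
  have h3 : ‖x‖ ≤ ‖x - gridPoint d m j‖ + ‖gridPoint d m j‖ := by
    simpa using norm_add_le (x - gridPoint d m j) (gridPoint d m j)
  have h4 : 1 / (3 * (m * d : ℝ)) ≤ 1 / m := by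
    gcongr
    nlinarith
  have h5 : (m - 1 : ℝ) / m = 1 - 1 / m := by field_simp
  linarith

end Grid

/-! ### Calibration of the bumps and the bound for a fixed grid -/

section Bump

variable {d : ℕ}

/-- The `L²(μ)`-norm of a dilated bump inside the support of the uniform distribution. -/
lemma lintegral_enorm_sq_bump_cond {Ω : Set (E d)} (hΩ0 : volume Ω ≠ 0) (hΩ1 : volume Ω ≠ ⊤)
    (hΩ : MeasurableSet Ω) {φ : E d → ℝ}
    (hφ : Continuous φ) (hs : tsupport φ ⊆ Metric.closedBall 0 1) {r : ℝ} (hr : 0 < r) {p : E d}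
    (hp : Metric.closedBall p (1 / r) ⊆ Ω) (K : ℝ) :
    ∫⁻ x, ‖K * φ (r • (x - p))‖ₑ ^ 2 ∂(cond volume Ω) =
      ENNReal.ofReal (K ^ 2 * (r ^ d)⁻¹ * ((∫ x, φ x ^ 2) / (volume Ω).toReal)) := by
  have hsq : ∀ y : ℝ, ‖y‖ₑ ^ 2 = ENNReal.ofReal (y ^ 2) := fun y => by
    rw [Real.enorm_eq_ofReal_abs, ← ENNReal.ofReal_pow (abs_nonneg _), sq_abs]
  have hc : HasCompactSupport φ :=
    (isCompact_closedBall 0 1).of_isClosed_subset (isClosed_tsupport _) hs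
  have hint : Integrable fun x => φ x ^ 2 :=
    (hφ.pow 2).integrable_of_hasCompactSupport (by
      simp only [sq]
      exact hc.mul_left (f := φ))
  have hint' : Integrable fun x => φ (r • (x - p)) ^ 2 :=
    (hint.comp_smul hr.ne').comp_sub_right p
  have hsupp : ∀ x ∉ Ω, φ (r • (x - p)) = 0 := by
    intro x hx
    by_contra h
    refine hx (hp ?_)
    have h1 := hs (subset_tsupport φ h)
    rw [mem_closedBall_zero_iff, norm_smul, Real.norm_of_nonneg hr.le] at h1
    rw [Metric.mem_closedBall, dist_eq_norm, le_div_iff₀ hr]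
    linarith
  have h1 : ∫⁻ x in Ω, ‖K * φ (r • (x - p))‖ₑ ^ 2 = ∫⁻ x, ‖K * φ (r • (x - p))‖ₑ ^ 2 := by
    rw [← lintegral_indicator hΩ]
    refine lintegral_congr fun x => ?_
    by_cases hx : x ∈ Ω
    · rw [Set.indicator_of_mem hx]
    · rw [Set.indicator_of_notMem hx, hsupp x hx]; simp
  have h2 : ∫ x, (K * φ (r • (x - p))) ^ 2 = K ^ 2 * (r ^ d)⁻¹ * ∫ x, φ x ^ 2 := by
    simp_rw [mul_pow]
    rw [integral_const_mul, integral_sub_right_eq_self (fun x => φ (r • x) ^ 2) p,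
      Measure.integral_comp_smul volume (fun x => φ x ^ 2) r, finrank_euclideanSpace_fin,
      abs_of_pos (by positivity), smul_eq_mul, mul_assoc]
  rw [ProbabilityTheory.cond, lintegral_smul_measure, h1]
  simp_rw [hsq]
  rw [← ofReal_integral_eq_lintegral_ofReal (by simpa only [mul_pow] using hint'.const_mul (K ^ 2))
    (ae_of_all _ fun x => sq_nonneg _), h2, smul_eq_mul]
  have hpos : 0 < (volume Ω).toReal := ENNReal.toReal_pos hΩ0 hΩ1
  rw [← mul_div_assoc, ENNReal.ofReal_div_of_pos hpos, ENNReal.ofReal_toReal hΩ1, mul_comm,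
    div_eq_mul_inv]

lemma sobolevNormOn_le_sobolevNorm (Ω : Set (E d)) (α : ℝ) (p : ℝ≥0∞) (f : E d → ℝ) :
    sobolevNormOn Ω α p f ≤ sobolevNorm α p f :=
  iInf₂_le (f := fun g (_ : g =ᵐ[volume.restrict Ω] f) => sobolevNorm α p g) f
    (Filter.EventuallyEq.refl _ _)

/-- A smooth profile, an amplitude and the resulting mass, for which all superpositions of
separated dilated bumps lie in the Sobolev unit ball. -/
lemma exists_profile (d : ℕ) {α : ℝ} (hα : 0 < α) {V₀ : ℝ} (hV₀ : 0 < V₀) {s : ℝ} (hs : 0 < s) :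
    ∃ (φ : E d → ℝ) (a : ℝ), Continuous φ ∧ tsupport φ ⊆ Metric.closedBall 0 1 ∧ 0 < a ∧
      0 < (∫ x, φ x ^ 2) / V₀ ∧ a ^ 2 * ((∫ x, φ x ^ 2) / V₀) ≤ s ^ 2 ∧
      ∀ {ι : Type} [Fintype ι] {r : ℝ} {p : ι → E d} {c : ι → ℝ} (Ω : Set (E d)),
        1 ≤ r → (∀ i j, i ≠ j → 2 / r < dist (p i) (p j)) → (∀ j, |c j| ≤ a * r ^ (-α)) →
          bumpSum c r p φ ∈ sobolevUnitBall Ω α ⊤ := by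
  let φ : ContDiffBump (0 : E d) := ⟨1 / 2, 1, by norm_num, by norm_num⟩
  have hφs : tsupport φ ⊆ Metric.closedBall 0 1 := φ.tsupport_eq.le
  obtain ⟨C, hC, hbound⟩ := exists_sobolevNorm_bumpSum_le hα (φ := φ) φ.contDiff hφs
  have hV : 0 < ∫ x, φ x ^ 2 := by
    refine Continuous.integral_pos_of_hasCompactSupport_nonneg_nonzero (x := 0)
      (φ.continuous.pow 2) ?_ (fun x => sq_nonneg _) ?_
    · simp only [sq]
      exact φ.hasCompactSupport.mul_left (f := φ)
    · rw [φ.one_of_mem_closedBall (Metric.mem_closedBall_self (by norm_num [φ]))]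
      norm_num
  set V := (∫ x, φ x ^ 2) / V₀ with hVdef
  have hV' : 0 < V := div_pos hV hV₀
  have hC0 : 0 ≤ C.toReal := ENNReal.toReal_nonneg
  -- The first entry secures the unit ball, with `+ 1` in case `C = 0`; the second secures the bound
  -- on the mass.
  refine ⟨φ, min (1 / (C.toReal + 1)) (s / √V), φ.continuous, hφs, by positivity, hV', ?_, ?_⟩
  · calc min (1 / (C.toReal + 1)) (s / √V) ^ 2 * V ≤ (s / √V) ^ 2 * V := by
          gcongr
          exact min_le_right _ _
      _ = s ^ 2 := by
          rw [div_pow, Real.sq_sqrt hV'.le]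
          field_simp
  · intro ι _ r p c Ω hr hp hc
    have hr0 : 0 < r := by linarith
    refine (sobolevNormOn_le_sobolevNorm _ _ _ _).trans
      ((hbound hr hp hc (by positivity)).trans ?_)
    rw [mul_assoc, ← Real.rpow_add hr0, neg_add_cancel, Real.rpow_zero, mul_one,
      ← ENNReal.ofReal_toReal hC, ← ENNReal.ofReal_mul hC0, ENNReal.ofReal_le_one,
      ENNReal.toReal_ofReal hC0]
    calc C.toReal * min (1 / (C.toReal + 1)) (s / √V) ≤ C.toReal * (1 / (C.toReal + 1)) := by
          gcongr
          exact min_le_left _ _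
      _ ≤ 1 := by
          rw [mul_one_div, div_le_one (by positivity)]
          linarith

/-- The lower bound from a grid with `m ^ d` points, for any `m` for which the hypotheses are
statistically indistinguishable. -/
lemma grid_le_minimaxRisk {α : ℝ} (hd : 1 ≤ d) {σ : ℝ≥0} (hσ : σ ≠ 0) (hα : 0 < α) {Ω : Set (E d)}
    (hΩ : MeasurableSet Ω) (hΩ0 : volume Ω ≠ 0) (hΩ1 : volume Ω ≠ ⊤)
    (hball : Metric.closedBall 0 1 ⊆ Ω) :
    ∃ b : ℝ, 0 < b ∧ ∀ n m : ℕ, 1 ≤ n → 1 ≤ m → (n : ℝ) ≤ (m : ℝ) ^ (2 * α + d) →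
      ENNReal.ofReal (b * (m : ℝ) ^ (-(2 * α))) ≤
        minimaxRisk (cond volume Ω) σ (sobolevUnitBall Ω α ⊤) n := by
  have hσ' : (0 : ℝ) < σ := by positivity
  have hd0 : (1 : ℝ) ≤ d := by exact_mod_cast hd
  have hprob : IsProbabilityMeasure (cond (volume : Measure (E d)) Ω) :=
    cond_isProbabilityMeasure_of_finite hΩ0 hΩ1
  obtain ⟨φ, a, hφ, hs, ha, hV, haV, hmem⟩ := exists_profile d hα
    (ENNReal.toReal_pos hΩ0 hΩ1) (s := 2 * σ) (by positivity)
  set V := (∫ x, φ x ^ 2) / (volume Ω).toReal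
  -- This is the constant in `m ^ d * S / 16` for `S = a ^ 2 * V * r ^ (-(2 * α + d))` and `r = 3 *
  -- d * m`.
  refine ⟨a ^ 2 * V / 16 * (3 * d : ℝ) ^ (-(2 * α + d)), by positivity, fun n m hn hm hnm => ?_⟩
  have hm1 : (1 : ℝ) ≤ m := by exact_mod_cast hm
  have hm0 : (0 : ℝ) < m := by linarith
  have hn0 : (0 : ℝ) < n := by exact_mod_cast hn
  set r : ℝ := 3 * (m * d) with hr
  have hmd : (1 : ℝ) ≤ m * d := one_le_mul_of_one_le_of_one_le hm1 hd0
  have hr1 : m ≤ r := by nlinarith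
  have hr0 : 0 < r := by linarith
  have hsep : ∀ i j, i ≠ j → 2 / r < dist (gridPoint d m i) (gridPoint d m j) :=
    fun i j hij => lt_dist_gridPoint hd hm hij
  have hK : (a * r ^ (-α)) ^ 2 * (r ^ d)⁻¹ = a ^ 2 * r ^ (-(2 * α + d)) := by
    rw [mul_pow, mul_assoc, ← Real.rpow_natCast (r ^ (-α)), ← Real.rpow_mul hr0.le,
      ← Real.rpow_natCast r, ← Real.rpow_neg hr0.le, ← Real.rpow_add hr0]
    congr 2
    push_cast
    ring
  have hmain := card_mul_le_minimaxRisk (cond volume Ω) hσ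
    (F := sobolevUnitBall Ω α ⊤) hn (ι := Fin d → Fin m)
    (g := fun j x => a * r ^ (-α) * φ (r • (x - gridPoint d m j)))
    (fun j => (by fun_prop : Continuous _).measurable)
    (B := fun j => Metric.closedBall (gridPoint d m j) (1 / r))
    (fun j => measurableSet_closedBall) ?_ ?_
    (S := ENNReal.ofReal (a ^ 2 * r ^ (-(2 * α + d)) * V)) ?_ ?_ ?_
  · refine le_trans (le_of_eq ?_) hmain
    have h16 : ENNReal.ofReal (a ^ 2 * r ^ (-(2 * α + d)) * V) / 16 =
        ENNReal.ofReal (a ^ 2 * r ^ (-(2 * α + d)) * V / 16) := by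
      rw [ENNReal.ofReal_div_of_pos (by norm_num)]
      simp
    rw [h16, Fintype.card_fun, Fintype.card_fin, Fintype.card_fin, ← ENNReal.ofReal_natCast,
      ← ENNReal.ofReal_mul (by positivity)]
    congr 1
    have hrm : r = 3 * d * m := by rw [hr]; ring
    have hmm : (m : ℝ) ^ (-(2 * α)) = (m : ℝ) ^ d * (m : ℝ) ^ (-(2 * α + d)) := by
      rw [← Real.rpow_natCast (m : ℝ) d, ← Real.rpow_add hm0]
      congr 1
      ring
    rw [hrm, Real.mul_rpow (by positivity) hm0.le, hmm]
    push_cast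
    ring
  · intro i j hij
    refine Metric.closedBall_disjoint_closedBall ?_
    have := hsep i j hij
    rwa [← add_div, one_add_one_eq_two]
  · intro j x hx
    have : φ (r • (x - gridPoint d m j)) = 0 := by
      by_contra h
      refine hx ?_
      have h1 := hs (subset_tsupport φ h)
      rw [mem_closedBall_zero_iff, norm_smul, Real.norm_of_nonneg hr0.le] at h1
      rw [Metric.mem_closedBall, dist_eq_norm, le_div_iff₀ hr0]
      linarith
    simp [this]
  · intro j
    rw [lintegral_enorm_sq_bump_cond hΩ0 hΩ1 hΩ hφ hs hr0
      ((closedBall_gridPoint_subset hd hm j).trans hball), hK]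
  · refine ENNReal.ofReal_le_ofReal ?_
    -- Hence `S ≤ a ^ 2 * V / n`, and the choice `s = 2σ` made `a ^ 2 * V ≤ 4σ²`.
    have h1 : (n : ℝ) ≤ r ^ (2 * α + d) := hnm.trans
      (Real.rpow_le_rpow hm0.le hr1 (by positivity))
    rw [Real.rpow_neg hr0.le, mul_right_comm, ← div_eq_mul_inv]
    have h2 : a ^ 2 * V ≤ 4 * (σ : ℝ) ^ 2 := haV.trans_eq (by ring)
    gcongr
  · intro ε
    have := hmem (c := fun j => if ε j then a * r ^ (-α) else 0) Ω (hm1.trans hr1) hsep ?_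
    · refine (congrArg (· ∈ sobolevUnitBall Ω α ⊤) ?_).mp this
      ext x
      simp only [bumpSum, ite_mul, zero_mul]
    · intro j
      have : 0 ≤ a * r ^ (-α) := by positivity
      split_ifs
      · rw [abs_of_nonneg this]
      · simpa using this

end Bump

end SobolevMinimax

theorem theorem4 (d : ℕ) (hd : 1 ≤ d) (α : ℝ) (hα : 0 < α) (σ : NNReal) (hσ : 0 < σ) :
    ∃ c : ℝ, 0 < c ∧ ∀ n : ℕ, 1 ≤ n →
      ENNReal.ofReal (c * (n : ℝ) ^ (-(2 * α / (2 * α + d)))) ≤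
        SobolevMinimax.minimaxRisk
          (ProbabilityTheory.cond MeasureTheory.volume
            (Metric.closedBall (0 : SobolevMinimax.E d) 1))
          σ (SobolevMinimax.sobolevUnitBall (Metric.closedBall (0 : SobolevMinimax.E d) 1) α ⊤) n := by
  obtain ⟨b, hb, hrisk⟩ := SobolevMinimax.grid_le_minimaxRisk (α := α) hd hσ.ne' hα
    (Ω := Metric.closedBall (0 : SobolevMinimax.E d) 1) measurableSet_closedBall
    (Metric.measure_closedBall_pos _ _ one_pos).ne' measure_closedBall_lt_top.ne subset_rfl
  -- The power of `2` pays for rounding: `⌈t⌉₊ ≤ 2 * t` because `t ≥ 1`.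
  refine ⟨b * 2 ^ (-(2 * α)), by positivity, fun n hn => ?_⟩
  have hn1 : (1 : ℝ) ≤ n := by exact_mod_cast hn
  have hs : 0 < 2 * α + d := by positivity
  -- `⌈t⌉₊` is the smallest `m` with `n ≤ m ^ (2α + d)`, and the bound decreases in `m`.
  set t : ℝ := (n : ℝ) ^ (1 / (2 * α + d)) with ht
  have ht1 : 1 ≤ t := Real.one_le_rpow hn1 (by positivity)
  have hle : t ≤ ⌈t⌉₊ := Nat.le_ceil t
  refine le_trans (ENNReal.ofReal_le_ofReal ?_) (hrisk n ⌈t⌉₊ hn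
    (Nat.one_le_iff_ne_zero.2 (Nat.ceil_pos.2 (by linarith)).ne') ?_)
  · have hlt : (⌈t⌉₊ : ℝ) ≤ 2 * t := by
      have := Nat.ceil_lt_add_one (by linarith : 0 ≤ t)
      linarith
    rw [mul_assoc]
    refine mul_le_mul_of_nonneg_left ?_ hb.le
    have h1 : (n : ℝ) ^ (-(2 * α / (2 * α + d))) = t ^ (-(2 * α)) := by
      rw [ht, ← Real.rpow_mul (by positivity)]
      congr 1
      ring
    rw [h1, ← Real.mul_rpow (by norm_num) (by linarith)]
    exact Real.rpow_le_rpow_of_nonpos (by linarith) hlt (by linarith)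
  · calc (n : ℝ) = t ^ (2 * α + d) := by
          rw [ht, ← Real.rpow_mul (by positivity), one_div_mul_cancel hs.ne', Real.rpow_one]
      _ ≤ _ := Real.rpow_le_rpow (by linarith) hle hs.le
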